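/- Let $G$ be a simply connected (finite-dimensional, real) Lie group whose Lie algebra $\mathfrak g$ is almost abelian, i.e. $\mathfrak g$ has an abelian ideal $\mathfrak u$ of codimension one; fix such a $\mathfrak u$. Let $\{J_\alpha\}_{\alpha=1,2,3}$ be a hypercomplex structure on $\mathfrak g$: endomorphisms of $\mathfrak g$ with $J_\alpha^2=-I$, $J_1J_2=-J_2J_1=J_3$ and $[x,y]+J_\alpha([J_\alpha x,y]+[x,J_\alpha y])-[J_\alpha x,J_\alpha y]=0$ for all $x,y\in\mathfrak g$ and all $\alpha$. Put $\mathfrak h=\mathfrak u\cap J_1\mathfrak u\cap J_2\mathfrak u\cap J_3\mathfrak u$. There exist $e_0\in\mathfrak g\setminus\mathfrak u$ and $\mu\in\mathbb R$ such that, for $\alpha=1,2,3$, $J_\alpha e_0\in\mathfrak u$ and $[e_0,J_\alpha e_0]-\mu J_\alpha e_0\in\mathfrak h$. The left invariant hypercomplex structure on $G$ determined by $\{J_\alpha\}$ admits an Obata connection, that is, a torsion-free affine connection $\nabla$ on $G$ with $\nabla J_\alpha=0$ for $\alpha=1,2,3$. For every such pair $(e_0,\mu)$ and every such $\nabla$,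 the connection $\nabla$ is geodesically complete (for every $p\in G$ and $v\in T_pG$ there is a geodesic $\gamma:\mathbb R\to G$ with $\gamma(0)=p$, $\gamma'(0)=v$) if and only if $\mu=0$. -/

import Mathlib

open scoped Manifold ContDiff Topology

noncomputable section

/-! ### Hypercomplex almost abelian Lie algebras -/

section LieAlgebra

variable {L : Type*} [LieRing L] [LieAlgebra ℝ L]

/-- `J 0, J 1, J 2` (the complex structures usually written `J₁, J₂, J₃`) form a hypercomplex
structure on the real Lie algebra `L`: they satisfy the quaternion relations and their
Nijenhuis tensors vanish. -/
structure IsHypercomplex (J : Fin 3 → Module.End ℝ L) : Prop where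
  sq : ∀ α, J α * J α = -1
  mul_eq : J 0 * J 1 = J 2
  mul_eq_neg : J 1 * J 0 = -J 2
  integrable : ∀ α x y,
    ⁅x, y⁆ + J α (⁅J α x, y⁆ + ⁅x, J α y⁆) - ⁅J α x, J α y⁆ = 0

/-- `u` is an abelian ideal of codimension one. A (finite-dimensional) Lie algebra is almost
abelian when it has such an ideal. -/
structure IsCodimOneAbelianIdeal (u : LieIdeal ℝ L) : Prop where
  abelian : ∀ x ∈ u, ∀ y ∈ u, ⁅x, y⁆ = 0
  codim_one : Module.finrank ℝ u + 1 = Module.finrank ℝ L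

/-- The subspace `𝔥 = 𝔲 ∩ J₁𝔲 ∩ J₂𝔲 ∩ J₃𝔲`. -/
def invariantCore (J : Fin 3 → Module.End ℝ L) (u : LieIdeal ℝ L) : Submodule ℝ L :=
  u.toSubmodule ⊓ ⨅ α, u.toSubmodule.map (J α)

/-- `e₀` is a vector outside `𝔲` with all `e_α = J_α e₀` in `𝔲`, and `μ` is the real number such
that `[e₀, e_α] = μ e_α + v_α` with `v_α ∈ 𝔥`. -/
structure IsAdapted (J : Fin 3 → Module.End ℝ L) (u : LieIdeal ℝ L) (e₀ : L) (μ : ℝ) : Prop where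
  notMem : e₀ ∉ u
  mem : ∀ α, J α e₀ ∈ u
  bracket : ∀ α, ∃ v ∈ invariantCore J u, ⁅e₀, J α e₀⁆ = μ • J α e₀ + v

end LieAlgebra

/-! ### Geodesics of an affine connection -/

section Geodesic

variable {E : Type*} [NormedAddCommGroup E] [NormedSpace ℝ E]
  {M : Type*} [TopologicalSpace M] [ChartedSpace E M] [IsManifold 𝓘(ℝ, E) 1 M]

/-- The velocity vector `γ'(t)` of a curve. -/
def velocity (γ : ℝ → M) (t : ℝ) : TangentSpace 𝓘(ℝ, E) (γ t) :=
  mfderiv 𝓘(ℝ, ℝ) 𝓘(ℝ, E) γ t (1 : ℝ)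

/-- The vector field `V` along the curve `γ` has covariant derivative `W` at time `t`: writing
`V = ∑ fᵢ (Xᵢ ∘ γ)` near `t`, with scalar functions `fᵢ` and vector fields `Xᵢ` on the manifold
(for example a local frame), one has `W = ∑ (fᵢ'(t) Xᵢ + fᵢ(t) ∇_{γ'(t)} Xᵢ)`. By the Leibniz
rule, `W` does not depend on how `V` is written. -/
def HasCovDerivAlongAt
    (cov : CovariantDerivative 𝓘(ℝ, E) E (TangentSpace 𝓘(ℝ, E) : M → Type _))
    (γ : ℝ → M) (V : Π t, TangentSpace 𝓘(ℝ, E) (γ t)) (t : ℝ)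
    (W : TangentSpace 𝓘(ℝ, E) (γ t)) : Prop :=
  ∃ (m : ℕ) (f : Fin m → ℝ → ℝ) (X : Fin m → Π p : M, TangentSpace 𝓘(ℝ, E) p),
    (∀ i, DifferentiableAt ℝ (f i) t) ∧
    (∀ i, MDiffAt (T% (X i)) (γ t)) ∧
    (∀ᶠ s in 𝓝 t, V s = ∑ i, f i s • X i (γ s)) ∧
    W = ∑ i, (deriv (f i) t • X i (γ t) + f i t • cov (X i) (γ t) (velocity γ t))

/-- `γ : ℝ → M` is a geodesic: `∇_{γ'} γ' = 0` at all times. (The second condition includes that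
`γ'` is differentiable; solutions of this equation are as smooth as the connection allows.) -/
structure IsGeodesic
    (cov : CovariantDerivative 𝓘(ℝ, E) E (TangentSpace 𝓘(ℝ, E) : M → Type _))
    (γ : ℝ → M) : Prop where
  mdifferentiable : MDifferentiable 𝓘(ℝ, ℝ) 𝓘(ℝ, E) γ
  covDeriv_velocity : ∀ t, HasCovDerivAlongAt cov γ (velocity γ) t 0

/-- Geodesic completeness: for every point `p` and every tangent vector `v` at `p` there is a
geodesic defined on all of `ℝ` with `γ(0) = p` and `γ'(0) = v`. -/
def IsGeodesicallyComplete
    (cov : CovariantDerivative 𝓘(ℝ, E) E (TangentSpace 𝓘(ℝ, E) : M → Type _)) : Prop :=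
  ∀ v : TangentBundle 𝓘(ℝ, E) M, ∃ γ : ℝ → M, IsGeodesic cov γ ∧
    (⟨γ 0, velocity γ 0⟩ : TangentBundle 𝓘(ℝ, E) M) = v

end Geodesic

/-! ### The Obata connection of a left invariant hypercomplex structure on a Lie group -/

section Obata

/-- Smooth Lie groups have the regularity Mathlib requires to define the Lie algebra. -/
instance instLEInftyMinSmoothnessThree : ENat.LEInfty (minSmoothness ℝ 3) :=
  ⟨by simpa using (ENat.LEInfty.out : (3 : ℕ∞ω) ≤ ∞)⟩

variable {E : Type*} [NormedAddCommGroup E] [NormedSpace ℝ E]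
  {G : Type*} [TopologicalSpace G] [ChartedSpace E G] [Group G]

/-- The left invariant field of endomorphisms of `TG` with value `A` at the identity: at `g` it is
`(dL_g)_1 ∘ A ∘ (dL_{g⁻¹})_g`. -/
def leftInvariantEnd (A : Module.End ℝ (GroupLieAlgebra 𝓘(ℝ, E) G)) (g : G)
    (v : TangentSpace 𝓘(ℝ, E) g) : TangentSpace 𝓘(ℝ, E) g :=
  mulInvariantVectorField (I := 𝓘(ℝ, E))
    (A (mfderiv 𝓘(ℝ, E) 𝓘(ℝ, E) (fun h : G ↦ g⁻¹ * h) g v)) g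

/-- `cov` is an Obata connection of the left invariant hypercomplex structure determined by `J`:
it is torsion-free and `∇ J_α = 0`, that is, `∇_w (J_α Y) = J_α ∇_w Y`, for all `α`. -/
structure IsObataConnection [FiniteDimensional ℝ E] [CompleteSpace E] [LieGroup 𝓘(ℝ, E) ∞ G]
    (J : Fin 3 → Module.End ℝ (GroupLieAlgebra 𝓘(ℝ, E) G))
    (cov : CovariantDerivative 𝓘(ℝ, E) E (TangentSpace 𝓘(ℝ, E) : G → Type _)) : Prop where
  torsion_eq_zero : cov.torsion = 0
  parallel : ∀ (α : Fin 3) (Y : Π g : G, TangentSpace 𝓘(ℝ, E) g) (g : G),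
    MDiffAt (T% Y) g → ∀ w : TangentSpace 𝓘(ℝ, E) g,
      cov (fun h ↦ leftInvariantEnd (J α) h (Y h)) g w = leftInvariantEnd (J α) g (cov Y g w)

end Obata

end

/-!
Choose a linear form `l` with kernel `𝔲` and `l(e₀) = 1`, and put `Φ = ad e₀ + l ⊗ w` with
`w = -J_α[e₀, J_α e₀]`. Integrability of the `J_α`, evaluated on `e₀` and an arbitrary vector, says
that `w` is independent of `α` and that `Φ` commutes with every `J_α`
(`IsHypercomplex.obataEnd_comm`). As `𝔲` is abelian, `[x, y] = l(x) Φ y - l(y) Φ x`, so the formula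
`∇_x y = l(x) Φ(y)` on left invariant fields defines a torsion-free connection preserving the `J_α`
(`IsHypercomplex.isObataConnection`). It is the only one: two such connections differ by a tensor
that is symmetric and `J`-linear, hence zero (`IsObataConnection.eq_of_mdifferentiableAt`).
Moreover `l ∘ Φ = μ l`, where `μ = l(w)` is the number occurring in an adapted pair
(`dual_obataEnd`, `IsAdapted.dual_eq`).

In the left trivialization, a curve with velocity `ξ` is a geodesic if and only if
`ξ' = -l(ξ) Φ ξ`. Applying `l` gives the Riccati equation `a' = -μ a²` for `a = l(ξ)`, which has
no global solution with `a(0) = 1` unless `μ = 0` (`eq_zero_of_isGeodesicallyComplete`). If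
`μ = 0`, then `a` is constant and `ξ(t) = exp(-a t Φ) ξ(0)` is defined for all times; the curve
itself is found by solving `γ' = γ · ξ`, which is globally possible on a Lie group because local
solutions can be left translated (`exists_isLeftSolutionOn_univ`).
-/

open scoped Manifold ContDiff Topology

noncomputable section

/-! ### Linear algebra of a hypercomplex structure -/

section Algebra

variable {L : Type*} [LieRing L] [LieAlgebra ℝ L]

theorem IsHypercomplex.apply_apply {J : Fin 3 → Module.End ℝ L} (hJ : IsHypercomplex J)
    (α : Fin 3) (x : L) : J α (J α x) = -x := by
  simpa using LinearMap.congr_fun (hJ.sq α) x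

theorem IsHypercomplex.apply_zero_one {J : Fin 3 → Module.End ℝ L} (hJ : IsHypercomplex J)
    (x : L) : J 0 (J 1 x) = J 2 x := by
  simpa using LinearMap.congr_fun hJ.mul_eq x

theorem IsHypercomplex.apply_one_zero {J : Fin 3 → Module.End ℝ L} (hJ : IsHypercomplex J)
    (x : L) : J 1 (J 0 x) = -J 2 x := by
  simpa using LinearMap.congr_fun hJ.mul_eq_neg x

theorem IsHypercomplex.apply_zero_two {J : Fin 3 → Module.End ℝ L} (hJ : IsHypercomplex J)
    (x : L) : J 0 (J 2 x) = -J 1 x := by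
  rw [← hJ.apply_zero_one, hJ.apply_apply]

theorem IsHypercomplex.apply_two_one {J : Fin 3 → Module.End ℝ L} (hJ : IsHypercomplex J)
    (x : L) : J 2 (J 1 x) = -J 0 x := by
  rw [← hJ.apply_zero_one, hJ.apply_apply, map_neg]

theorem IsHypercomplex.apply_two_zero {J : Fin 3 → Module.End ℝ L} (hJ : IsHypercomplex J)
    (x : L) : J 2 (J 0 x) = J 1 x := by
  have := hJ.apply_one_zero (J 0 x)
  rw [hJ.apply_apply, map_neg] at this
  exact (neg_injective this).symm

theorem IsHypercomplex.apply_one_two {J : Fin 3 → Module.End ℝ L} (hJ : IsHypercomplex J)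
    (x : L) : J 1 (J 2 x) = J 0 x := by
  rw [← neg_neg (J 2 x), ← hJ.apply_one_zero, map_neg, hJ.apply_apply, neg_neg]

theorem IsHypercomplex.mem_invariantCore {J : Fin 3 → Module.End ℝ L} (hJ : IsHypercomplex J)
    {u : LieIdeal ℝ L} {x : L} : x ∈ invariantCore J u ↔ x ∈ u ∧ ∀ α, J α x ∈ u := by
  simp only [invariantCore, Submodule.mem_inf, Submodule.mem_iInf, Submodule.mem_map,
    LieSubmodule.mem_toSubmodule]
  refine and_congr_right fun _ => forall_congr' fun α => ⟨?_, fun h => ⟨-J α x, ?_, ?_⟩⟩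
  · rintro ⟨y, hy, rfl⟩
    rw [hJ.apply_apply]
    exact neg_mem hy
  · exact neg_mem h
  · rw [map_neg, hJ.apply_apply, neg_neg]

theorem IsHypercomplex.map_mem_invariantCore {J : Fin 3 → Module.End ℝ L}
    (hJ : IsHypercomplex J) {u : LieIdeal ℝ L} {x : L} (hx : x ∈ invariantCore J u) (α : Fin 3) :
    J α x ∈ invariantCore J u := by
  obtain ⟨h, hα⟩ := hJ.mem_invariantCore.1 hx
  refine hJ.mem_invariantCore.2 ⟨hα α, fun β => ?_⟩
  fin_cases α <;> fin_cases β <;>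
    simp [hJ.apply_apply, hJ.apply_zero_one, hJ.apply_one_zero, hJ.apply_zero_two,
      hJ.apply_two_one, hJ.apply_two_zero, hJ.apply_one_two, h, hα]

/-- A vector outside `u` determines the linear form with kernel `u` and value `1` at it. -/
theorem IsCodimOneAbelianIdeal.exists_dual [FiniteDimensional ℝ L] {u : LieIdeal ℝ L}
    (hu : IsCodimOneAbelianIdeal u) {e : L} (he : e ∉ u) :
    ∃ l : L →ₗ[ℝ] ℝ, l e = 1 ∧ ∀ x, l x = 0 ↔ x ∈ u := by
  obtain ⟨f, hf, hfu⟩ := Submodule.exists_le_ker_of_notMem (p := u.toSubmodule) (v := e) he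
  have hker : u.toSubmodule = LinearMap.ker f := by
    refine Submodule.eq_of_le_of_finrank_le hfu ?_
    have h1 : Module.finrank ℝ (LinearMap.ker f) < Module.finrank ℝ L := by
      refine Submodule.finrank_lt fun h => hf ?_
      rw [← LinearMap.mem_ker, h]
      trivial
    have h2 : Module.finrank ℝ u.toSubmodule + 1 = Module.finrank ℝ L := hu.codim_one
    omega
  refine ⟨(f e)⁻¹ • f, by simp [hf], fun x => ?_⟩
  rw [← LieSubmodule.mem_toSubmodule, hker]
  simp [hf]

theorem IsHypercomplex.exists_transversal [FiniteDimensional ℝ L] {J : Fin 3 → Module.End ℝ L}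
    (hJ : IsHypercomplex J) {u : LieIdeal ℝ L} (hu : IsCodimOneAbelianIdeal u) :
    ∃ e, e ∉ u ∧ ∀ α, J α e ∈ u := by
  obtain ⟨x, hx⟩ : ∃ x, x ∉ u := by
    by_contra! h
    have h1 := hu.codim_one
    have : u = ⊤ := by ext; simp [h]
    subst this
    have h2 : Module.finrank ℝ ((⊤ : LieIdeal ℝ L).toSubmodule) = Module.finrank ℝ L := by
      rw [LieSubmodule.top_toSubmodule, finrank_top]
    have h3 : Module.finrank ℝ ((⊤ : LieIdeal ℝ L).toSubmodule) + 1 = Module.finrank ℝ L := h1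
    omega
  obtain ⟨l, hl, hlu⟩ := hu.exists_dual hx
  -- With `q = l(x) + l(J₀ x) i + l(J₁ x) j + l(J₂ x) k`, the vector `q · x` is annihilated by all
  -- the forms `l ∘ J α`, while `l (q · x) = |q|²`.
  refine ⟨x + l (J 0 x) • J 0 x + l (J 1 x) • J 1 x + l (J 2 x) • J 2 x, ?_, fun α => ?_⟩
  · rw [← hlu]
    simp only [map_add, map_smul, smul_eq_mul, hl]
    nlinarith [mul_self_nonneg (l (J 0 x)), mul_self_nonneg (l (J 1 x)),
      mul_self_nonneg (l (J 2 x))]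
  · rw [← hlu]
    fin_cases α <;>
    simp only [Fin.zero_eta, Fin.mk_one, Fin.reduceFinMk, map_add, map_smul, map_neg, smul_eq_mul,
      hJ.apply_apply, hJ.apply_zero_one, hJ.apply_one_zero, hJ.apply_zero_two,
      hJ.apply_two_one, hJ.apply_two_zero, hJ.apply_one_two, hl] <;> ring

/-- The endomorphism `Φ` of `L` with `Φ = ad e` on the kernel of the linear form `l` and
`Φ e = -J₀[e, J₀ e]`, where `l e = 1`. The Obata connection is `∇_x y = l(x) Φ(y)` on left
invariant fields. -/
def obataEnd (J : Fin 3 → Module.End ℝ L) (l : L →ₗ[ℝ] ℝ) (e : L) : Module.End ℝ L :=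
  LieAlgebra.ad ℝ L e - l.smulRight (J 0 ⁅e, J 0 e⁆)

theorem obataEnd_apply (J : Fin 3 → Module.End ℝ L) (l : L →ₗ[ℝ] ℝ) (e x : L) :
    obataEnd J l e x = ⁅e, x⁆ - l x • J 0 ⁅e, J 0 e⁆ := by
  simp [obataEnd]

variable {J : Fin 3 → Module.End ℝ L} {u : LieIdeal ℝ L} {l : L →ₗ[ℝ] ℝ} {e : L}

theorem IsCodimOneAbelianIdeal.lie_eq (hu : IsCodimOneAbelianIdeal u) (hle : l e = 1)
    (hlu : ∀ x, l x = 0 ↔ x ∈ u) (x y : L) : ⁅x, y⁆ = l x • ⁅e, y⁆ - l y • ⁅e, x⁆ := by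
  have h := hu.abelian (x - l x • e) ((hlu _).1 (by simp [hle]))
    (y - l y • e) ((hlu _).1 (by simp [hle]))
  simp only [sub_lie, lie_sub, smul_lie, lie_smul, lie_self, smul_zero, sub_zero] at h
  rw [← lie_skew e x, smul_neg, sub_neg_eq_add]
  linear_combination (norm := module) (1 : ℝ) • h

/-- Integrability of `J α`, evaluated on `e` and `J β e`, shows that the vector `J α [e, J α e]` does
not depend on `α`. -/
theorem IsHypercomplex.map_lie_eq (hJ : IsHypercomplex J) (hu : IsCodimOneAbelianIdeal u)
    (hJe : ∀ α, J α e ∈ u) (α : Fin 3) :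
    J α ⁅e, J α e⁆ = J 0 ⁅e, J 0 e⁆ := by
  have h (α β) : ⁅e, J β e⁆ + J α ⁅e, J α (J β e)⁆ - ⁅J α e, J α (J β e)⁆ = 0 := by
    have := hJ.integrable α e (J β e)
    rwa [hu.abelian _ (hJe α) _ (hJe β), zero_add] at this
  have h1 := congrArg (J 1) (h 0 1)
  have h0 := congrArg (J 0) (h 1 0)
  simp only [hJ.apply_zero_one, hJ.apply_one_zero, lie_neg, hu.abelian _ (hJe _) _ (hJe 2),
    map_neg, map_add, neg_zero, sub_zero, map_zero] at h0 h1
  have h02 : J 0 ⁅e, J 0 e⁆ = J 2 ⁅e, J 2 e⁆ := by linear_combination (norm := module) (1 : ℝ) • h0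
  have h12 : J 1 ⁅e, J 1 e⁆ = J 2 ⁅e, J 2 e⁆ := by linear_combination (norm := module) (1 : ℝ) • h1
  fin_cases α
  · rfl
  · exact h12.trans h02.symm
  · exact h02.symm

/-- Integrability of `J α`, evaluated on `e` and an arbitrary vector, says precisely that
`obataEnd J l e` commutes with `J α`. -/
theorem IsHypercomplex.obataEnd_comm (hJ : IsHypercomplex J) (hu : IsCodimOneAbelianIdeal u)
    (hle : l e = 1) (hlu : ∀ x, l x = 0 ↔ x ∈ u) (hJe : ∀ α, J α e ∈ u) (α : Fin 3) (x : L) :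
    obataEnd J l e (J α x) = J α (obataEnd J l e x) := by
  have hN := hJ.integrable α e x
  have hl : l (J α e) = 0 := (hlu _).2 (hJe α)
  rw [hu.lie_eq hle hlu (J α e) x, hu.lie_eq hle hlu (J α e) (J α x), hl] at hN
  simp only [zero_smul, zero_sub, map_add, map_neg, map_smul] at hN
  have hw := hJ.map_lie_eq hu hJe α
  have hN' := congrArg (J α) hN
  simp only [map_add, map_neg, map_smul, map_sub, hJ.apply_apply, map_zero] at hN'
  simp only [obataEnd_apply, map_sub, map_smul, ← hw, hJ.apply_apply]
  linear_combination (norm := module) (-1 : ℝ) • hN'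

theorem lie_mem_of_dual (hle : l e = 1) (hlu : ∀ x, l x = 0 ↔ x ∈ u) (x : L) :
    ⁅e, x⁆ ∈ u := by
  have h := lie_mem_right ℝ L u e (x - l x • e) ((hlu _).1 (by simp [hle]))
  simpa using h

/-- `[e, x]` lies in `u = ker l`, so `l ∘ Φ` is a multiple of `l`; the factor is the number `μ` of
an adapted pair, by `IsAdapted.dual_eq`. -/
theorem dual_obataEnd (hle : l e = 1) (hlu : ∀ x, l x = 0 ↔ x ∈ u) (x : L) :
    l (obataEnd J l e x) = -l (J 0 ⁅e, J 0 e⁆) * l x := by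
  rw [obataEnd_apply, map_sub, (hlu _).2 (lie_mem_of_dual hle hlu x), map_smul,
    smul_eq_mul]
  ring

theorem IsAdapted.dual_eq (hJ : IsHypercomplex J) {μ : ℝ} (h : IsAdapted J u e μ) (hle : l e = 1)
    (hlu : ∀ x, l x = 0 ↔ x ∈ u) : -l (J 0 ⁅e, J 0 e⁆) = μ := by
  obtain ⟨v, hv, hb⟩ := h.bracket 0
  have hv0 : l (J 0 v) = 0 := (hlu _).2 ((hJ.mem_invariantCore.1 hv).2 0)
  rw [hb]
  simp [hJ.apply_apply, hle, hv0]

theorem IsHypercomplex.isAdapted (hJ : IsHypercomplex J) (hu : IsCodimOneAbelianIdeal u)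
    (hle : l e = 1) (hlu : ∀ x, l x = 0 ↔ x ∈ u) (hJe : ∀ α, J α e ∈ u) :
    IsAdapted J u e (-l (J 0 ⁅e, J 0 e⁆)) where
  notMem h := by simp [(hlu _).2 h] at hle
  mem := hJe
  bracket α := by
    -- `w = Φ e` satisfies `[e, J β e] = J β w`, so the remainder is `J α (w - l(w) e)`
    set w := -J 0 ⁅e, J 0 e⁆ with hw
    have hJw (β : Fin 3) : J β w = ⁅e, J β e⁆ := by
      rw [hw, ← hJ.map_lie_eq hu hJe β, map_neg, hJ.apply_apply, neg_neg]
    refine ⟨J α (w - l w • e), hJ.map_mem_invariantCore (hJ.mem_invariantCore.2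
      ⟨(hlu _).1 (by simp [hle]), fun β => ?_⟩) α, ?_⟩
    · rw [map_sub, map_smul, hJw]
      exact sub_mem (lie_mem_of_dual hle hlu _) (u.smul_mem _ (hJe β))
    · rw [map_sub, map_smul, hJw, hw, map_neg]
      abel

end Algebra

/-! ### The left trivialization of the tangent bundle -/

section LeftTrivialization

open Bundle

theorem tangentBundle_mk_eq {E : Type*} [NormedAddCommGroup E] [NormedSpace ℝ E]
    {M : Type*} [TopologicalSpace M] [ChartedSpace E M] {a b : M} (h : a = b) {x y : E}
    (hxy : x = y) : (⟨a, x⟩ : TangentBundle 𝓘(ℝ, E) M) = ⟨b, y⟩ := by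
  subst h hxy
  rfl

variable {E : Type*} [NormedAddCommGroup E] [NormedSpace ℝ E]
  {G : Type*} [TopologicalSpace G] [ChartedSpace E G] [Group G]

variable (E) in
/-- The left trivialization `T_g G → T_1 G` of the tangent bundle of a Lie group, i.e. the
derivative at `g` of left multiplication by `g⁻¹`. The derivative takes values in the tangent
space at `g⁻¹ * g`; this and the Lie algebra both unfold to the model space `E`, which serves as
codomain. -/
def leftTriv (g : G) : TangentSpace 𝓘(ℝ, E) g →L[ℝ] E :=
  mfderiv 𝓘(ℝ, E) 𝓘(ℝ, E) (fun h : G ↦ g⁻¹ * h) g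

theorem leftInvariantEnd_eq (A : Module.End ℝ (GroupLieAlgebra 𝓘(ℝ, E) G)) (g : G)
    (v : TangentSpace 𝓘(ℝ, E) g) :
    leftInvariantEnd A g v = mulInvariantVectorField (I := 𝓘(ℝ, E)) (A (leftTriv E g v)) g := rfl

variable (E) in
/-- The inverse `T_1 G → T_g G` of the left trivialization, as a continuous linear map. -/
def leftTrivSymm (g : G) : E →L[ℝ] TangentSpace 𝓘(ℝ, E) g where
  toFun x := mulInvariantVectorField (I := 𝓘(ℝ, E)) (x : GroupLieAlgebra 𝓘(ℝ, E) G) g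
  map_add' x y := congrFun (mulInvariantVectorField_add (I := 𝓘(ℝ, E)) (G := G) x y) g
  map_smul' c x := congrFun (mulInvariantVectorField_smul (I := 𝓘(ℝ, E)) (G := G) c x) g
  cont := (mfderiv 𝓘(ℝ, E) 𝓘(ℝ, E) (fun h : G ↦ g * h) 1).cont

variable [LieGroup 𝓘(ℝ, E) ∞ G]

theorem mdifferentiableAt_const_mul (a g : G) :
    MDifferentiableAt 𝓘(ℝ, E) 𝓘(ℝ, E) (fun h : G ↦ a * h) g :=
  (contMDiff_mul_left (I := 𝓘(ℝ, E)) (n := ∞) (a := a)).mdifferentiableAt (by simp)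

theorem leftTriv_leftTrivSymm (g : G) (x : E) :
    leftTriv E g (leftTrivSymm E g x) = x := by
  have h := mfderiv_comp_of_eq (x := (1 : G)) (y := g) (I := 𝓘(ℝ, E)) (I' := 𝓘(ℝ, E))
    (I'' := 𝓘(ℝ, E)) (f := fun h : G ↦ g * h) (g := fun h : G ↦ g⁻¹ * h)
    (mdifferentiableAt_const_mul _ _) (mdifferentiableAt_const_mul _ _) (mul_one g)
  have h2 : (fun h : G ↦ g⁻¹ * h) ∘ (fun h : G ↦ g * h) = id := by ext; simp
  rw [h2, mfderiv_id] at h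
  have h4 : mfderiv 𝓘(ℝ, E) 𝓘(ℝ, E) (fun h : G ↦ g⁻¹ * h) (g * 1) = leftTriv E g := by
    rw [leftTriv, mul_one]
  rw [← h4]
  exact (congrArg (fun T => T x) h).symm

theorem leftTrivSymm_leftTriv (g : G) (v : TangentSpace 𝓘(ℝ, E) g) :
    leftTrivSymm E g (leftTriv E g v) = v := by
  have h := mfderiv_comp_of_eq (x := g) (y := 1) (I := 𝓘(ℝ, E)) (I' := 𝓘(ℝ, E))
    (I'' := 𝓘(ℝ, E)) (f := fun h : G ↦ g⁻¹ * h) (g := fun h : G ↦ g * h)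
    (mdifferentiableAt_const_mul _ _) (mdifferentiableAt_const_mul _ _) (inv_mul_cancel g)
  have h2 : (fun h : G ↦ g * h) ∘ (fun h : G ↦ g⁻¹ * h) = id := by ext; simp
  rw [h2, mfderiv_id] at h
  have h4 : mfderiv 𝓘(ℝ, E) 𝓘(ℝ, E) (fun h : G ↦ g * h) (g⁻¹ * g) (leftTriv E g v) =
      leftTrivSymm E g (leftTriv E g v) := by
    rw [inv_mul_cancel]
    rfl
  rw [← h4]
  exact (congrArg (fun T => T v) h).symm

/-- The coordinates of a vector field in the left trivialization. -/
def leftCoord (Y : Π g : G, TangentSpace 𝓘(ℝ, E) g) : G → E := fun h ↦ leftTriv E h (Y h)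

/-- The derivative of the multiplication sends `(0_a, v)` to the left translate of `v` by `a`. -/
theorem tangentMap_mul_symm (a b : G) (v : TangentSpace 𝓘(ℝ, E) b) :
    tangentMap (𝓘(ℝ, E).prod 𝓘(ℝ, E)) 𝓘(ℝ, E) (fun p : G × G ↦ p.1 * p.2)
      ((equivTangentBundleProd 𝓘(ℝ, E) G 𝓘(ℝ, E) G).symm (⟨a, 0⟩, ⟨b, v⟩)) =
    ⟨a * b, mfderiv 𝓘(ℝ, E) 𝓘(ℝ, E) (fun h : G ↦ a * h) b v⟩ := by
  have h : MDifferentiableAt (𝓘(ℝ, E).prod 𝓘(ℝ, E)) 𝓘(ℝ, E) (fun p : G × G ↦ p.1 * p.2) (a, b) :=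
    (contMDiff_mul 𝓘(ℝ, E) ∞).mdifferentiableAt (by simp)
  have h2 := mfderiv_prod_eq_add_apply h (v := ((equivTangentBundleProd 𝓘(ℝ, E) G 𝓘(ℝ, E) G).symm
    ((⟨a, 0⟩, ⟨b, v⟩) : TangentBundle 𝓘(ℝ, E) G × TangentBundle 𝓘(ℝ, E) G)).2)
  have h3 : mfderiv 𝓘(ℝ, E) 𝓘(ℝ, E) (fun z : G ↦ z * b) a 0 = 0 := map_zero _
  refine congrArg (TotalSpace.mk (a * b)) (h2.trans ?_)
  exact (congrArg (fun w : TangentSpace 𝓘(ℝ, E) (a * b) =>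
    w + mfderiv 𝓘(ℝ, E) 𝓘(ℝ, E) (fun h : G ↦ a * h) b v) h3).trans (zero_add _)

variable (E G) in
/-- The tangent space at `1` read in the preferred trivialization of the tangent bundle at `1`, as a
linear automorphism of the model space. It reduces differentiability of a map into the fibre over
`1` to differentiability of a map into a vector space. -/
def fiberCoord : E ≃L[ℝ] E :=
  (trivializationAt E (TangentSpace 𝓘(ℝ, E)) (1 : G)).continuousLinearEquivAt ℝ 1
    (FiberBundle.mem_baseSet_trivializationAt' 1)

theorem mdifferentiableAt_leftCoord {Y : Π g : G, TangentSpace 𝓘(ℝ, E) g} {g : G}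
    (hY : MDiffAt (T% Y) g) : MDifferentiableAt 𝓘(ℝ, E) 𝓘(ℝ, E) (leftCoord Y) g := by
  have h1 : MDifferentiableAt 𝓘(ℝ, E) 𝓘(ℝ, E).tangent
      (fun h : G ↦ (⟨h⁻¹, 0⟩ : TangentBundle 𝓘(ℝ, E) G)) g :=
    ((contMDiff_zeroSection ℝ (TangentSpace 𝓘(ℝ, E) : G → Type _) (IB := 𝓘(ℝ, E))
      (n := 1)).comp ((contMDiff_inv 𝓘(ℝ, E) ∞).of_le (by simp))).mdifferentiableAt (by simp)
  have h2 := (contMDiff_equivTangentBundleProd_symm (n := 1) (I := 𝓘(ℝ, E)) (M := G)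
    (I' := 𝓘(ℝ, E)) (M' := G)).mdifferentiable (by simp)
  have h3 : MDifferentiable (𝓘(ℝ, E).prod 𝓘(ℝ, E)).tangent 𝓘(ℝ, E).tangent
      (tangentMap (𝓘(ℝ, E).prod 𝓘(ℝ, E)) 𝓘(ℝ, E) (fun p : G × G ↦ p.1 * p.2)) :=
    (ContMDiff.contMDiff_tangentMap (m := 1) (n := ∞) (contMDiff_mul 𝓘(ℝ, E) ∞)
      (one_add_one_eq_two.trans_le ENat.LEInfty.out)).mdifferentiable (by simp)
  have h4 := (h3 _).comp g ((h2 _).comp g (h1.prodMk hY))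
  have h5 : MDifferentiableAt 𝓘(ℝ, E) 𝓘(ℝ, E).tangent
      (fun h : G ↦ (⟨1, leftTriv E h (Y h)⟩ : TangentBundle 𝓘(ℝ, E) G)) g := by
    have h : (fun h : G ↦ (⟨1, leftTriv E h (Y h)⟩ : TangentBundle 𝓘(ℝ, E) G)) = _ :=
      funext fun h => (tangentBundle_mk_eq (inv_mul_cancel h).symm rfl).trans
        (tangentMap_mul_symm h⁻¹ h (Y h)).symm
    rw [h]
    exact h4
  have h6 := ((mdifferentiableAt_totalSpace _ _).1 h5).2
  have h7 : MDifferentiableAt 𝓘(ℝ, E) 𝓘(ℝ, E) (fun h => fiberCoord E G (leftCoord Y h)) g := h6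
  have h8 : MDifferentiableAt 𝓘(ℝ, E) 𝓘(ℝ, E)
      (fun h => (fiberCoord E G).symm (fiberCoord E G (leftCoord Y h))) g := 
    ((fiberCoord E G).symm.toContinuousLinearMap.differentiableAt.mdifferentiableAt).comp g h7
  simpa using h8

theorem contMDiff_mulInvariantVectorField_prod {ξ : ℝ → E} (hξ : ContDiff ℝ 1 ξ) :
    ContMDiff (𝓘(ℝ, E).prod 𝓘(ℝ, ℝ)) 𝓘(ℝ, E).tangent 1 (fun p : G × ℝ ↦
      (⟨p.1, leftTrivSymm E p.1 (ξ p.2)⟩ : TangentBundle 𝓘(ℝ, E) G)) := by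
  have h1 : ContMDiff (𝓘(ℝ, E).prod 𝓘(ℝ, ℝ)) 𝓘(ℝ, E).tangent 1
      (fun p : G × ℝ ↦ (⟨p.1, 0⟩ : TangentBundle 𝓘(ℝ, E) G)) :=
    (contMDiff_zeroSection ℝ (TangentSpace 𝓘(ℝ, E) : G → Type _) (IB := 𝓘(ℝ, E))
      (n := 1)).comp contMDiff_fst
  have h1' : ContMDiff (𝓘(ℝ, E).prod 𝓘(ℝ, ℝ)) 𝓘(ℝ, E).tangent 1
      (fun p : G × ℝ ↦ (⟨1, ξ p.2⟩ : TangentBundle 𝓘(ℝ, E) G)) := by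
    intro p
    refine (contMDiffAt_totalSpace).2 ⟨contMDiffAt_const, ?_⟩
    exact ((((fiberCoord E G).toContinuousLinearMap.contDiff.comp hξ).contMDiff).comp
      contMDiff_snd).contMDiffAt
  have h2 := (contMDiff_equivTangentBundleProd_symm (n := 1) (I := 𝓘(ℝ, E)) (M := G)
    (I' := 𝓘(ℝ, E)) (M' := G))
  have h3 : ContMDiff (𝓘(ℝ, E).prod 𝓘(ℝ, E)).tangent 𝓘(ℝ, E).tangent 1
      (tangentMap (𝓘(ℝ, E).prod 𝓘(ℝ, E)) 𝓘(ℝ, E) (fun p : G × G ↦ p.1 * p.2)) :=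
    ContMDiff.contMDiff_tangentMap (m := 1) (n := ∞) (contMDiff_mul 𝓘(ℝ, E) ∞)
      (one_add_one_eq_two.trans_le ENat.LEInfty.out)
  have h : (fun p : G × ℝ ↦ (⟨p.1, leftTrivSymm E p.1 (ξ p.2)⟩ : TangentBundle 𝓘(ℝ, E) G)) = _ :=
    funext fun p => (tangentBundle_mk_eq (mul_one p.1).symm rfl).trans
      (tangentMap_mul_symm p.1 1 (ξ p.2)).symm
  rw [h]
  exact h3.comp (h2.comp (h1.prodMk h1'))

end LeftTrivialization

/-! ### Left invariant connections and uniqueness of the Obata connection -/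

section Connection

open Bundle

variable {E : Type*} [NormedAddCommGroup E] [NormedSpace ℝ E]
  {G : Type*} [TopologicalSpace G] [ChartedSpace E G] [Group G] [LieGroup 𝓘(ℝ, E) ∞ G]

theorem leftCoord_leftTrivSymm (x : E) :
    leftCoord (fun g : G => leftTrivSymm E g x) = fun _ => x :=
  funext fun g => leftTriv_leftTrivSymm g x

variable (E) in
theorem mdifferentiableAt_leftTrivSymm (x : E) (g : G) :
    MDiffAt (T% (fun h : G => leftTrivSymm E h x)) g :=
  mdifferentiableAt_mulInvariantVectorField (I := 𝓘(ℝ, E)) x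

/-- The left invariant connection with `∇_x y = B x y` for left invariant vector fields `x`, `y`:
in the left trivialization, `∇_w Y = dY(w) + B(w, Y)`. -/
def leftInvariantConnection (B : E →L[ℝ] E →L[ℝ] E) :
    CovariantDerivative 𝓘(ℝ, E) E (TangentSpace 𝓘(ℝ, E) : G → Type _) where
  toFun Y g := leftTrivSymm E g ∘L
    (mvfderiv 𝓘(ℝ, E) (leftCoord Y) g +
      (B.flip (leftCoord Y g)) ∘L leftTriv E g)
  isCovariantDerivativeOnUniv :=
    { add := by
        intro Y Z g hY hZ _
        have h : leftCoord (Y + Z) = leftCoord Y + leftCoord Z :=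
          funext fun h => map_add (leftTriv E h) (Y h) (Z h)
        rw [h, mvfderiv_add (mdifferentiableAt_leftCoord hY) (mdifferentiableAt_leftCoord hZ)]
        refine ContinuousLinearMap.ext fun w => ?_
        change leftTrivSymm E g ((mvfderiv 𝓘(ℝ, E) (leftCoord Y) g w +
          mvfderiv 𝓘(ℝ, E) (leftCoord Z) g w) + B (leftTriv E g w) (leftCoord Y g + leftCoord Z g)) =
          leftTrivSymm E g (mvfderiv 𝓘(ℝ, E) (leftCoord Y) g w + B (leftTriv E g w) (leftCoord Y g)) +
          leftTrivSymm E g (mvfderiv 𝓘(ℝ, E) (leftCoord Z) g w + B (leftTriv E g w) (leftCoord Z g))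
        rw [← map_add, map_add (B _)]
        congr 1
        abel
      leibniz := by
        intro Y f g hY hf _
        have h : leftCoord (f • Y) = f • leftCoord Y :=
          funext fun h => map_smul (leftTriv E h) (f h) (Y h)
        have h2 : leftTrivSymm E g (leftCoord Y g) = Y g := leftTrivSymm_leftTriv g (Y g)
        rw [h, mvfderiv_smul hf (mdifferentiableAt_leftCoord hY)]
        refine ContinuousLinearMap.ext fun w => ?_
        change leftTrivSymm E g ((f g • mvfderiv 𝓘(ℝ, E) (leftCoord Y) g w +
          mvfderiv 𝓘(ℝ, E) f g w • leftCoord Y g) + B (leftTriv E g w) (f g • leftCoord Y g)) =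
          f g • leftTrivSymm E g (mvfderiv 𝓘(ℝ, E) (leftCoord Y) g w +
            B (leftTriv E g w) (leftCoord Y g)) + mvfderiv 𝓘(ℝ, E) f g w • Y g
        rw [← h2, ← (leftTrivSymm E g).map_smul, ← (leftTrivSymm E g).map_smul,
          ← (leftTrivSymm E g).map_add, (B _).map_smul]
        congr 1
        module }

theorem leftTriv_leftInvariantConnection (B : E →L[ℝ] E →L[ℝ] E)
    (Y : Π g : G, TangentSpace 𝓘(ℝ, E) g) (g : G) (w : TangentSpace 𝓘(ℝ, E) g) :
    leftTriv E g (leftInvariantConnection B Y g w) =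
      mvfderiv 𝓘(ℝ, E) (leftCoord Y) g w + B (leftTriv E g w) (leftCoord Y g) :=
  leftTriv_leftTrivSymm g _

theorem leftInvariantConnection_leftTrivSymm (B : E →L[ℝ] E →L[ℝ] E)
    (x y : E) (g : G) :
    leftInvariantConnection B (fun h => leftTrivSymm E h y) g (leftTrivSymm E g x) =
      leftTrivSymm E g (B x y) := by
  rw [← leftTrivSymm_leftTriv g (leftInvariantConnection B _ g _),
    leftTriv_leftInvariantConnection, leftTriv_leftTrivSymm, leftCoord_leftTrivSymm,
    mvfderiv_const]
  exact congrArg _ (zero_add _)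

variable [CompleteSpace E]

theorem mlieBracket_leftTrivSymm (x y : GroupLieAlgebra 𝓘(ℝ, E) G) (g : G) :
    VectorField.mlieBracket 𝓘(ℝ, E) (fun h : G => leftTrivSymm E h x) (fun h => leftTrivSymm E h y) g =
      leftTrivSymm E g (⁅x, y⁆ : GroupLieAlgebra 𝓘(ℝ, E) G) :=
  (congrFun (mulInvariantVector_mlieBracket (I := 𝓘(ℝ, E)) x y) g).symm

variable [FiniteDimensional ℝ E]

theorem torsion_leftInvariantConnection (B : E →L[ℝ] E →L[ℝ] E)
    (hB : ∀ x y : GroupLieAlgebra 𝓘(ℝ, E) G, B x y - B y x = (⁅x, y⁆ : GroupLieAlgebra 𝓘(ℝ, E) G)) :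
    (leftInvariantConnection (G := G) B).torsion = 0 := by
  refine funext fun g => ContinuousLinearMap.ext fun v => ContinuousLinearMap.ext fun w => ?_
  have h := (leftInvariantConnection (G := G) B).torsion_apply
    (mdifferentiableAt_leftTrivSymm E (leftTriv E g v) g)
    (mdifferentiableAt_leftTrivSymm E (leftTriv E g w) g)
  rw [leftInvariantConnection_leftTrivSymm, leftInvariantConnection_leftTrivSymm,
    mlieBracket_leftTrivSymm (leftTriv E g v) (leftTriv E g w), leftTrivSymm_leftTriv,
    leftTrivSymm_leftTriv, ← map_sub,
    hB (leftTriv E g v) (leftTriv E g w), sub_self] at h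
  exact h

theorem isObataConnection_leftInvariantConnection (B : E →L[ℝ] E →L[ℝ] E)
    (hB : ∀ x y : GroupLieAlgebra 𝓘(ℝ, E) G, B x y - B y x = (⁅x, y⁆ : GroupLieAlgebra 𝓘(ℝ, E) G))
    (J : Fin 3 → Module.End ℝ (GroupLieAlgebra 𝓘(ℝ, E) G))
    (hBJ : ∀ α (x y : GroupLieAlgebra 𝓘(ℝ, E) G), B x (J α y) = J α (B x y)) :
    IsObataConnection J (leftInvariantConnection (G := G) B) where
  torsion_eq_zero := torsion_leftInvariantConnection B hB
  parallel α Y g hY w := by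
    let A : E →L[ℝ] E := LinearMap.toContinuousLinearMap (J α : E →ₗ[ℝ] E)
    have hA : leftCoord (fun h ↦ leftInvariantEnd (J α) h (Y h)) = A ∘ leftCoord Y :=
      funext fun h => leftTriv_leftTrivSymm h _
    have hd : mvfderiv 𝓘(ℝ, E) (A ∘ leftCoord Y) g w = A (mvfderiv 𝓘(ℝ, E) (leftCoord Y) g w) := by
      have h1 := mfderiv_comp_apply (I'' := 𝓘(ℝ, E)) g A.differentiableAt.mdifferentiableAt
        (mdifferentiableAt_leftCoord hY) w
      rw [mfderiv_eq_fderiv, A.fderiv] at h1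
      exact h1
    rw [leftInvariantEnd_eq, leftTriv_leftInvariantConnection,
      ← leftTrivSymm_leftTriv g (leftInvariantConnection B _ g w),
      leftTriv_leftInvariantConnection, hA, hd]
    refine congrArg (leftTrivSymm E g) ?_
    have h2 : B (leftTriv E g w) (A (leftCoord Y g)) = A (B (leftTriv E g w) (leftCoord Y g)) :=
      hBJ α _ _
    exact (congrArg _ h2).trans (map_add A _ _).symm

/-- Two Obata connections differ by a tensor that is symmetric and `J`-linear in each argument;
since `J 0` and `J 1` anticommute, such a tensor vanishes. -/
theorem IsObataConnection.eq_of_mdifferentiableAt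
    {J : Fin 3 → Module.End ℝ (GroupLieAlgebra 𝓘(ℝ, E) G)} (hJ : IsHypercomplex J)
    {cov cov' : CovariantDerivative 𝓘(ℝ, E) E (TangentSpace 𝓘(ℝ, E) : G → Type _)}
    (h : IsObataConnection J cov) (h' : IsObataConnection J cov')
    {Y : Π g : G, TangentSpace 𝓘(ℝ, E) g} {g : G} (hY : MDiffAt (T% Y) g) :
    cov Y g = cov' Y g := by
  -- `D y x` is the difference tensor, on the Lie algebra
  let A (α : Fin 3) : E →ₗ[ℝ] E := J α
  let D (y x : E) : E :=
    leftTriv E g (cov.difference cov' g (leftTrivSymm E g y) (leftTrivSymm E g x))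
  have hdiff (y x : E) :
      cov.difference cov' g (leftTrivSymm E g y) (leftTrivSymm E g x) =
        cov (fun h => leftTrivSymm E h y) g (leftTrivSymm E g x) -
          cov' (fun h => leftTrivSymm E h y) g (leftTrivSymm E g x) :=
    congrArg (fun T => T (leftTrivSymm E g x)) <|
      cov.isCovariantDerivativeOnUniv.difference_apply cov'.isCovariantDerivativeOnUniv
        (Set.mem_univ g) (mdifferentiableAt_leftTrivSymm E y g)
  have hsymm (y x) : D y x = D x y := by
    have h1 := cov.torsion_eq_zero_iff.1 h.torsion_eq_zero (mdifferentiableAt_leftTrivSymm E x g)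
      (mdifferentiableAt_leftTrivSymm E y g)
    have h2 := cov'.torsion_eq_zero_iff.1 h'.torsion_eq_zero (mdifferentiableAt_leftTrivSymm E x g)
      (mdifferentiableAt_leftTrivSymm E y g)
    have h3 := h1.trans h2.symm
    simp only [D, hdiff]
    congr 1
    rw [sub_eq_sub_iff_sub_eq_sub]
    exact h3
  have hpar {c : CovariantDerivative 𝓘(ℝ, E) E (TangentSpace 𝓘(ℝ, E) : G → Type _)}
      (hc : IsObataConnection J c) (α) (y x : E) :
      leftTriv E g (c (fun h => leftTrivSymm E h (A α y)) g (leftTrivSymm E g x)) =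
        A α (leftTriv E g (c (fun h => leftTrivSymm E h y) g (leftTrivSymm E g x))) := by
    have h1 := hc.parallel α _ g (mdifferentiableAt_leftTrivSymm E y g) (leftTrivSymm E g x)
    have h2 : (fun h : G ↦ leftInvariantEnd (J α) h (leftTrivSymm E h y)) =
        fun h : G => leftTrivSymm E h (A α y) :=
      funext fun h => congrArg (fun z => leftTrivSymm E h (A α z)) (leftTriv_leftTrivSymm h y)
    rw [h2] at h1
    rw [h1]
    exact leftTriv_leftTrivSymm g _
  have hlin (α) (y x) : D (A α y) x = A α (D y x) := by
    simp only [D, hdiff]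
    rw [map_sub, hpar h, hpar h', map_sub, map_sub]
  have hzero (y x) : D y x = 0 := by
    have h2 : D (A 0 y) (A 1 x) = A 0 (A 1 (D y x)) := by
      rw [hlin, hsymm, hlin, hsymm]
    have h3 : D (A 0 y) (A 1 x) = A 1 (A 0 (D y x)) := by
      rw [hsymm, hlin, hsymm, hlin]
    have h01 : A 0 (A 1 (D y x)) = A 2 (D y x) := hJ.apply_zero_one _
    have h10 : A 1 (A 0 (D y x)) = -A 2 (D y x) := hJ.apply_one_zero _
    have h22 : A 2 (A 2 (D y x)) = -D y x := hJ.apply_apply _ _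
    rw [h2, h01, h10, eq_neg_iff_add_eq_zero, ← two_smul ℝ] at h3
    rwa [(smul_eq_zero.1 h3).resolve_left two_ne_zero, map_zero, eq_comm, neg_eq_zero] at h22
  have h1 := cov.isCovariantDerivativeOnUniv.difference_apply cov'.isCovariantDerivativeOnUniv
    (Set.mem_univ g) hY
  rw [← sub_eq_zero, ← h1]
  refine ContinuousLinearMap.ext fun w => ?_
  have h2 := congrArg (leftTrivSymm E g) (hzero (leftTriv E g (Y g)) (leftTriv E g w))
  simp only [D, leftTrivSymm_leftTriv] at h2
  exact h2.trans (map_zero _)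

end Connection

/-! ### The geodesic equation in the left trivialization -/

section GeodesicEquation

open Bundle

theorem velocity_eq_of_hasMFDerivAt {E : Type*} [NormedAddCommGroup E] [NormedSpace ℝ E]
    {M : Type*} [TopologicalSpace M] [ChartedSpace E M] {γ : ℝ → M} {t : ℝ}
    {v : TangentSpace 𝓘(ℝ, E) (γ t)}
    (h : HasMFDerivAt 𝓘(ℝ, ℝ) 𝓘(ℝ, E) γ t ((1 : ℝ →L[ℝ] ℝ).smulRight v)) :
    velocity γ t = v := by
  rw [velocity, h.mfderiv]
  exact one_smul ℝ v

variable {E : Type*} [NormedAddCommGroup E] [NormedSpace ℝ E]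
  {G : Type*} [TopologicalSpace G] [ChartedSpace E G] [Group G] [LieGroup 𝓘(ℝ, E) ∞ G]
  {cov : CovariantDerivative 𝓘(ℝ, E) E (TangentSpace 𝓘(ℝ, E) : G → Type _)}
  {B : E →L[ℝ] E →L[ℝ] E}

/-- In the left trivialization, the covariant derivative along a curve with velocity `ξ` is
`V' + B ξ V`. -/
theorem HasCovDerivAlongAt.hasDerivAt
    (hcov : ∀ (Y : Π g : G, TangentSpace 𝓘(ℝ, E) g) (g : G), MDiffAt (T% Y) g →
      cov Y g = leftInvariantConnection B Y g)
    {γ : ℝ → G} {V : Π t, TangentSpace 𝓘(ℝ, E) (γ t)} {t : ℝ}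
    {W : TangentSpace 𝓘(ℝ, E) (γ t)} (hγ : MDifferentiableAt 𝓘(ℝ, ℝ) 𝓘(ℝ, E) γ t)
    (h : HasCovDerivAlongAt cov γ V t W) :
    HasDerivAt (fun s => leftTriv E (γ s) (V s))
      (leftTriv E (γ t) W - B (leftTriv E (γ t) (velocity γ t)) (leftTriv E (γ t) (V t))) t := by
  obtain ⟨m, f, X, hf, hX, hV, rfl⟩ := h
  have hsum : (fun s => leftTriv E (γ s) (V s)) =ᶠ[𝓝 t]
      fun s => ∑ i, f i s • leftCoord (X i) (γ s) := by
    filter_upwards [hV] with s hs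
    rw [hs, map_sum]
    exact Finset.sum_congr rfl fun i _ => map_smul _ _ _
  have hder (i : Fin m) : HasDerivAt (fun s => leftCoord (X i) (γ s))
      (mvfderiv 𝓘(ℝ, E) (leftCoord (X i)) (γ t) (velocity γ t)) t := by
    have h1 := (mdifferentiableAt_leftCoord (hX i)).hasMFDerivAt.comp t hγ.hasMFDerivAt
    let T : ℝ →L[ℝ] E :=
      (mvfderiv 𝓘(ℝ, E) (leftCoord (X i)) (γ t)).comp (mfderiv 𝓘(ℝ, ℝ) 𝓘(ℝ, E) γ t)
    have h2 : HasFDerivAt (fun s => leftCoord (X i) (γ s)) T t := hasMFDerivAt_iff_hasFDerivAt.1 h1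
    exact h2.hasDerivAt
  have hmain := HasDerivAt.fun_sum (u := Finset.univ) fun i _ => (hf i).hasDerivAt.smul (hder i)
  have hVt := hsum.self_of_nhds
  refine (hmain.congr_of_eventuallyEq hsum).congr_deriv ?_
  simp only at hVt
  rw [hVt, map_sum, map_sum, ← Finset.sum_sub_distrib]
  refine Finset.sum_congr rfl fun i _ => ?_
  rw [map_add, map_smul, map_smul, map_smul, hcov _ _ (hX i), leftTriv_leftInvariantConnection]
  change _ = deriv (f i) t • leftCoord (X i) (γ t) + _ - _
  module

theorem isGeodesic_of_hasMFDerivAt [FiniteDimensional ℝ E]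
    (hcov : ∀ (Y : Π g : G, TangentSpace 𝓘(ℝ, E) g) (g : G), MDiffAt (T% Y) g →
      cov Y g = leftInvariantConnection B Y g)
    {γ : ℝ → G} {ξ : ℝ → E} (hξ : ∀ t, HasDerivAt ξ (-B (ξ t) (ξ t)) t)
    (hγ : ∀ t, HasMFDerivAt 𝓘(ℝ, ℝ) 𝓘(ℝ, E) γ t
      ((1 : ℝ →L[ℝ] ℝ).smulRight (leftTrivSymm E (γ t) (ξ t)))) :
    IsGeodesic cov γ where
  mdifferentiable t := (hγ t).mdifferentiableAt
  covDeriv_velocity t := by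
    let b := Module.finBasis ℝ E
    have hvel (s : ℝ) := velocity_eq_of_hasMFDerivAt (hγ s)
    let c (i) : E →L[ℝ] ℝ := LinearMap.toContinuousLinearMap (b.coord i)
    have hc (i) : HasDerivAt (fun s => c i (ξ s)) (c i (-B (ξ t) (ξ t))) t :=
      (c i).hasFDerivAt.comp_hasDerivAt t (hξ t)
    have hb (x : E) : ∑ i, c i x • b i = x := b.sum_repr x
    refine ⟨_, fun i s => c i (ξ s), fun i g => leftTrivSymm E g (b i),
      fun i => (hc i).differentiableAt, fun i => mdifferentiableAt_leftTrivSymm E _ _,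
      .of_forall fun s => ?_, ?_⟩
    · rw [hvel s, ← hb (ξ s), map_sum]
      simp only [map_smul]
    · have h1 (i) : cov (fun g => leftTrivSymm E g (b i)) (γ t) (velocity γ t) =
          leftTrivSymm E (γ t) (B (ξ t) (b i)) := by
        rw [hcov _ _ (mdifferentiableAt_leftTrivSymm E _ _), hvel,
          leftInvariantConnection_leftTrivSymm]
      simp only [h1, (hc _).deriv, ← map_smul, ← map_add]
      rw [← map_sum, Finset.sum_add_distrib, hb, ← map_sum, hb, neg_add_cancel, map_zero]

end GeodesicEquation

/-! ### Global solutions of `γ' = γ · ξ` -/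

section LeftODE

open Bundle Set

variable {E : Type*} [NormedAddCommGroup E] [NormedSpace ℝ E]
  {G : Type*} [TopologicalSpace G] [ChartedSpace E G] [Group G]

/-- The curve `γ` in the Lie group satisfies `γ' = γ · ξ` on `s`, for a curve `ξ` in the Lie
algebra (identified with the model space `E`). -/
def IsLeftSolutionOn (ξ : ℝ → E) (γ : ℝ → G) (s : Set ℝ) : Prop :=
  ∀ t ∈ s, HasMFDerivAt 𝓘(ℝ, ℝ) 𝓘(ℝ, E) γ t
    ((1 : ℝ →L[ℝ] ℝ).smulRight (leftTrivSymm E (γ t) (ξ t)))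

/-- The vector field `(ξ(τ), ∂_τ)` on `G × ℝ` whose integral curves are the graphs of the solutions
of `γ' = γ · ξ`. -/
def suspension (ξ : ℝ → E) (p : G × ℝ) : TangentSpace (𝓘(ℝ, E).prod 𝓘(ℝ, ℝ)) p :=
  ((leftTrivSymm E p.1 (ξ p.2), (1 : ℝ)) : E × ℝ)

variable {ξ : ℝ → E} {γ : ℝ → G} {s : Set ℝ}

theorem IsLeftSolutionOn.isMIntegralCurveOn (h : IsLeftSolutionOn ξ γ s) :
    IsMIntegralCurveOn (I := 𝓘(ℝ, E).prod 𝓘(ℝ, ℝ)) (fun t => (γ t, t)) (suspension ξ) s := by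
  intro t ht
  refine HasMFDerivAt.hasMFDerivWithinAt ?_
  refine ((h t ht).prodMk (hasMFDerivAt_id (I := 𝓘(ℝ, ℝ)) t)).congr_mfderiv ?_
  refine ContinuousLinearMap.ext fun r : ℝ => ?_
  exact Prod.ext (α := E) (β := ℝ) rfl (mul_one r).symm

theorem snd_of_isMIntegralCurveOn {a b t₀ : ℝ} {c : ℝ → G × ℝ}
    (h : IsMIntegralCurveOn (I := 𝓘(ℝ, E).prod 𝓘(ℝ, ℝ)) c (suspension ξ) (Ioo a b))
    (ht₀ : t₀ ∈ Ioo a b) (h₀ : (c t₀).2 = t₀) {t : ℝ} (ht : t ∈ Ioo a b) : (c t).2 = t := by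
  have hd (t : ℝ) (ht : t ∈ Ioo a b) : HasDerivAt (fun t => (c t).2 - t) 0 t := by
    have h1 := (h t ht).hasMFDerivAt (isOpen_Ioo.mem_nhds ht)
    have h2 := (hasMFDerivAt_snd (I := 𝓘(ℝ, E)) (I' := 𝓘(ℝ, ℝ)) (x := c t)).comp t h1
    have h3 : HasDerivAt (fun t => (c t).2) 1 t := by
      have h4 : HasFDerivAt (fun t => (c t).2) ((1 : ℝ →L[ℝ] ℝ).smulRight (1 : ℝ)) t :=
        hasMFDerivAt_iff_hasFDerivAt.1 h2
      simpa using h4.hasDerivAt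
    exact (h3.sub (hasDerivAt_id t)).congr_deriv (sub_self 1)
  have h4 := isOpen_Ioo.is_const_of_deriv_eq_zero isPreconnected_Ioo
    (fun t ht => (hd t ht).differentiableAt.differentiableWithinAt)
    (fun t ht => (hd t ht).deriv) ht ht₀
  simp only [h₀, sub_self] at h4
  linarith

theorem isLeftSolutionOn_of_isMIntegralCurveOn {c : ℝ → G × ℝ} (hs : IsOpen s)
    (h : IsMIntegralCurveOn (I := 𝓘(ℝ, E).prod 𝓘(ℝ, ℝ)) c (suspension ξ) s)
    (hc : ∀ t ∈ s, (c t).2 = t) : IsLeftSolutionOn ξ (fun t => (c t).1) s := by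
  intro t ht
  have h1 := (h t ht).hasMFDerivAt (hs.mem_nhds ht)
  have h2 := (hasMFDerivAt_fst (I := 𝓘(ℝ, E)) (I' := 𝓘(ℝ, ℝ)) (x := c t)).comp t h1
  refine h2.congr_mfderiv (ContinuousLinearMap.ext fun r : ℝ => ?_)
  exact congrArg (fun τ => r • leftTrivSymm E (c t).1 (ξ τ)) (hc t ht)

variable [LieGroup 𝓘(ℝ, E) ∞ G]

theorem contMDiff_suspension (hξ : ContDiff ℝ 1 ξ) :
    ContMDiff (𝓘(ℝ, E).prod 𝓘(ℝ, ℝ)) (𝓘(ℝ, E).prod 𝓘(ℝ, ℝ)).tangent 1 (fun p : G × ℝ ↦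
      (⟨p, suspension ξ p⟩ : TangentBundle (𝓘(ℝ, E).prod 𝓘(ℝ, ℝ)) (G × ℝ))) := by
  have h1 : ContMDiff 𝓘(ℝ, ℝ) 𝓘(ℝ, ℝ).tangent 1
      (fun t : ℝ => (⟨t, (1 : ℝ)⟩ : TangentBundle 𝓘(ℝ, ℝ) ℝ)) :=
    contMDiff_vectorSpace_iff_contDiff.2 contDiff_const
  exact (contMDiff_equivTangentBundleProd_symm (n := 1) (I := 𝓘(ℝ, E)) (M := G)
    (I' := 𝓘(ℝ, ℝ)) (M' := ℝ)).comp
    ((contMDiff_mulInvariantVectorField_prod hξ).prodMk (h1.comp contMDiff_snd))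

theorem mfderiv_mul_left_leftTrivSymm (a g : G) (x : E) :
    mfderiv 𝓘(ℝ, E) 𝓘(ℝ, E) (fun h : G => a * h) g (leftTrivSymm E g x) =
      leftTrivSymm E (a * g) x := by
  have h := mfderiv_comp_of_eq (x := (1 : G)) (y := g) (I := 𝓘(ℝ, E)) (I' := 𝓘(ℝ, E))
    (I'' := 𝓘(ℝ, E)) (f := fun h : G ↦ g * h) (g := fun h : G ↦ a * h)
    (mdifferentiableAt_const_mul _ _) (mdifferentiableAt_const_mul _ _) (mul_one g)
  have h2 : (fun h : G ↦ a * h) ∘ (fun h : G ↦ g * h) = fun h => a * g * h := by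
    ext; simp [mul_assoc]
  rw [h2] at h
  have h3 : mfderiv 𝓘(ℝ, E) 𝓘(ℝ, E) (fun h : G ↦ a * h) (g * 1) (leftTrivSymm E g x) =
      mfderiv 𝓘(ℝ, E) 𝓘(ℝ, E) (fun h : G ↦ a * h) g (leftTrivSymm E g x) := by
    rw [mul_one]
  rw [← h3]
  exact (congrArg (fun T => T x) h).symm

theorem IsLeftSolutionOn.mul_left (h : IsLeftSolutionOn ξ γ s) (a : G) :
    IsLeftSolutionOn ξ (fun t => a * γ t) s := by
  intro t ht
  have h1 := (mdifferentiableAt_const_mul (E := E) a (γ t)).hasMFDerivAt.comp t (h t ht)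
  refine h1.congr_mfderiv (ContinuousLinearMap.ext fun r : ℝ => ?_)
  refine ((mfderiv 𝓘(ℝ, E) 𝓘(ℝ, E) (fun h : G => a * h) (γ t)).map_smul r
    (leftTrivSymm E (γ t) (ξ t))).trans ?_
  rw [mfderiv_mul_left_leftTrivSymm]
  rfl

/-- Two solutions on overlapping intervals can be glued, after left translation of the second. -/
theorem IsLeftSolutionOn.exists_extension [T2Space G] (hξ : ContDiff ℝ 1 ξ) {γ₁ γ₂ : ℝ → G}
    {a b a' b' t₀ : ℝ} (h₁ : IsLeftSolutionOn ξ γ₁ (Ioo a b))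
    (h₂ : IsLeftSolutionOn ξ γ₂ (Ioo a' b')) (ht₀ : t₀ ∈ Ioo a b ∩ Ioo a' b') :
    ∃ γ : ℝ → G, EqOn γ γ₁ (Ioo a b) ∧ IsLeftSolutionOn ξ γ (Ioo a b ∪ Ioo a' b') := by
  have h₂' := h₂.mul_left (γ₁ t₀ * (γ₂ t₀)⁻¹)
  have h := isMIntegralCurveOn_piecewise (contMDiff_suspension hξ) h₁.isMIntegralCurveOn
    h₂'.isMIntegralCurveOn ht₀ (by simp)
  refine ⟨_, fun t ht => ?_, isLeftSolutionOn_of_isMIntegralCurveOn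
    (isOpen_Ioo.union isOpen_Ioo) h fun t _ => ?_⟩
  · rw [piecewise_eq_of_mem _ _ _ ht]
  · by_cases ht : t ∈ Ioo a b <;> simp [ht]

theorem exists_isLeftSolutionOn_nhds (hξ : ContDiff ℝ 1 ξ) [CompleteSpace E] (t₀ : ℝ) :
    ∃ ε > 0, ∃ γ : ℝ → G, IsLeftSolutionOn ξ γ (Ioo (t₀ - ε) (t₀ + ε)) := by
  obtain ⟨c, hc, h⟩ := exists_isMIntegralCurveAt_of_contMDiffAt_boundaryless t₀
    (contMDiff_suspension hξ ((1, t₀) : G × ℝ))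
  obtain ⟨ε, hε, h⟩ := isMIntegralCurveAt_iff'.1 h
  rw [Real.ball_eq_Ioo] at h
  exact ⟨ε, hε, _, isLeftSolutionOn_of_isMIntegralCurveOn isOpen_Ioo h fun t ht =>
    snd_of_isMIntegralCurveOn h (t₀ := t₀) (by simpa using hε) (by rw [hc]) ht⟩

/-- The equation `γ' = γ · ξ` on a Lie group is globally solvable: by left invariance, the local
solutions near a time `t₀` extend every solution reaching a time close to `t₀`. -/
theorem exists_isLeftSolutionOn_univ [T2Space G] [CompleteSpace E] (hξ : ContDiff ℝ 1 ξ) (p : G) :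
    ∃ γ : ℝ → G, γ 0 = p ∧ IsLeftSolutionOn ξ γ univ := by
  suffices H : ∀ A : ℝ, ∃ γ : ℝ → G, γ 0 = p ∧ IsLeftSolutionOn ξ γ (Ioo (-A) A) by
    obtain ⟨c, hc, h⟩ := (exists_isMIntegralCurve_iff_exists_isMIntegralCurveOn_Ioo
      (contMDiff_suspension hξ) ((p, 0) : G × ℝ)).2 fun A => by
        obtain ⟨γ, hγ, h⟩ := H A
        exact ⟨fun t => (γ t, t), by simp [hγ], h.isMIntegralCurveOn⟩
    refine ⟨fun t => (c t).1, by simp [hc], fun t _ => ?_⟩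
    refine isLeftSolutionOn_of_isMIntegralCurveOn isOpen_univ (h.isMIntegralCurveOn _)
      (fun t _ => ?_) t trivial
    refine snd_of_isMIntegralCurveOn (a := -(|t| + 1)) (b := |t| + 1) (t₀ := 0)
      (h.isMIntegralCurveOn _) ⟨?_, ?_⟩ (by rw [hc]) ⟨?_, ?_⟩
    all_goals linarith [abs_nonneg t, le_abs_self t, neg_abs_le t]
  by_contra! hA
  obtain ⟨A, hA⟩ := hA
  -- otherwise there is a largest symmetric interval `(-m, m)` of existence; glue to the solution the
  -- local ones near `m` and `-m`
  let S := {a : ℝ | ∃ γ : ℝ → G, γ 0 = p ∧ IsLeftSolutionOn ξ γ (Ioo (-a) a)}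
  have hbdd : BddAbove S := by
    refine ⟨A, fun a ⟨γ, hγ, h⟩ => ?_⟩
    by_contra! hlt
    exact hA γ hγ fun t ht => h t ⟨by linarith [ht.1], by linarith [ht.2]⟩
  obtain ⟨ε₀, hε₀, hmem⟩ : ∃ ε > 0, ε ∈ S := by
    obtain ⟨ε, hε, γ, h⟩ := exists_isLeftSolutionOn_nhds (G := G) hξ 0
    refine ⟨ε, hε, fun t => p * (γ 0)⁻¹ * γ t, by simp, ?_⟩
    simpa using h.mul_left (p * (γ 0)⁻¹)
  set m := sSup S with hm
  have hmpos : 0 < m := hε₀.trans_le (le_csSup hbdd hmem)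
  obtain ⟨ε₁, hε₁, γ₁, h₁⟩ := exists_isLeftSolutionOn_nhds (G := G) hξ m
  obtain ⟨ε₂, hε₂, γ₂, h₂⟩ := exists_isLeftSolutionOn_nhds (G := G) hξ (-m)
  obtain ⟨ε, hε, hle₁, hle₂⟩ : ∃ ε > 0, ε ≤ ε₁ ∧ ε ≤ ε₂ :=
    ⟨min ε₁ ε₂, lt_min hε₁ hε₂, min_le_left _ _, min_le_right _ _⟩
  obtain ⟨a, ⟨γ, hγ, h⟩, ha⟩ := exists_lt_of_lt_csSup ⟨_, hmem⟩
    (max_lt (sub_lt_self m hε) hmpos : max (m - ε) 0 < m)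
  have ha0 : 0 < a := (le_max_right _ _).trans_lt ha
  have ham : m - ε < a := (le_max_left _ _).trans_lt ha
  obtain ⟨t₁, ht₁, ht₁'⟩ := exists_between (max_lt ham (neg_lt_self ha0) : max (m - ε) (-a) < a)
  rw [max_lt_iff] at ht₁
  have ham' : a ≤ m := le_csSup hbdd ⟨γ, hγ, h⟩
  obtain ⟨γ', hγ', h'⟩ := h.exists_extension hξ h₁ (t₀ := t₁)
    ⟨⟨ht₁.2, ht₁'⟩, by linarith, by linarith⟩
  have h'' : IsLeftSolutionOn ξ γ' (Ioo (-a) (m + ε)) := fun t ht => h' t <| by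
    rcases lt_or_ge t a with hta | hta
    · exact .inl ⟨ht.1, hta⟩
    · exact .inr ⟨by linarith, by linarith [ht.2]⟩
  obtain ⟨γ'', hγ'', h'''⟩ := h''.exists_extension hξ h₂ (t₀ := -t₁)
    ⟨⟨by linarith, by linarith⟩, by linarith, by linarith⟩
  have hmem' : m + ε ∈ S := by
    refine ⟨γ'', ?_, fun t ht => h''' t ?_⟩
    · rw [hγ'' ⟨by linarith, by linarith⟩, hγ' ⟨by linarith, ha0⟩, hγ]
    · rcases lt_or_ge (-a) t with hta | hta
      · exact .inl ⟨hta, ht.2⟩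
      · exact .inr ⟨by linarith [ht.1], by linarith⟩
  linarith [le_csSup hbdd hmem']

end LeftODE

/-! ### Completeness of the Obata connection -/

section Riccati

/-- The Riccati equation `a' = -μ a²` with `a(0) = 1` has a global solution only if `μ = 0`. -/
theorem eq_zero_of_riccati {μ : ℝ} {a : ℝ → ℝ} (h : ∀ t, HasDerivAt a (-(μ * a t ^ 2)) t)
    (h₀ : a 0 = 1) : μ = 0 := by
  by_contra hμ
  have hcont : Continuous fun t => μ * a t :=
    continuous_const.mul (continuous_iff_continuousAt.2 fun t => (h t).continuousAt)
  let P (t : ℝ) : ℝ := ∫ s in (0 : ℝ)..t, μ * a s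
  have hP (t) : HasDerivAt P (μ * a t) t := hcont.integral_hasStrictDerivAt 0 t |>.hasDerivAt
  -- `c = a(t) (1 + μ t) - 1` solves the linear equation `c' = -μ a c`, and `c(0) = 0`
  have hc (t) : HasDerivAt (fun t => (a t * (1 + μ * t) - 1) * Real.exp (P t)) 0 t := by
    have h1 : HasDerivAt (fun t => 1 + μ * t) μ t := by
      simpa using ((hasDerivAt_id t).const_mul μ).const_add 1
    refine ((((h t).mul h1).sub_const 1).mul (hP t).exp).congr_deriv ?_
    simp only [Pi.mul_apply]
    ring
  have hconst := is_const_of_deriv_eq_zero (fun t => (hc t).differentiableAt)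
    (fun t => (hc t).deriv) (-μ⁻¹) 0
  simp [h₀, hμ, Real.exp_ne_zero] at hconst

end Riccati

section Obata

variable {E : Type*} [NormedAddCommGroup E] [NormedSpace ℝ E] [FiniteDimensional ℝ E]
    {G : Type*} [TopologicalSpace G] [ChartedSpace E G] [Group G]

instance GroupLieAlgebra.instFiniteDimensional : FiniteDimensional ℝ (GroupLieAlgebra 𝓘(ℝ, E) G) :=
  inferInstanceAs (FiniteDimensional ℝ E)

/-- The bilinear map `(x, y) ↦ l(x) Φ(y)` on the model space `E`, for a linear form `l` and an
endomorphism `Φ` of the Lie algebra. -/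
def rankOneBilin (l : GroupLieAlgebra 𝓘(ℝ, E) G →ₗ[ℝ] ℝ)
    (Φ : Module.End ℝ (GroupLieAlgebra 𝓘(ℝ, E) G)) : E →L[ℝ] E →L[ℝ] E :=
  let l' : E →ₗ[ℝ] ℝ := l
  let Φ' : E →ₗ[ℝ] E := Φ
  (LinearMap.toContinuousLinearMap l').smulRight (LinearMap.toContinuousLinearMap Φ')

variable [LieGroup 𝓘(ℝ, E) ∞ G]
  {l : GroupLieAlgebra 𝓘(ℝ, E) G →ₗ[ℝ] ℝ} {e : GroupLieAlgebra 𝓘(ℝ, E) G}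
  {cov : CovariantDerivative 𝓘(ℝ, E) E (TangentSpace 𝓘(ℝ, E) : G → Type _)}
  {Φ : Module.End ℝ (GroupLieAlgebra 𝓘(ℝ, E) G)} {μ : ℝ}

/-- If `l ∘ Φ = μ l`, then the component `a = l(γ')` of a geodesic satisfies `a' = -μ a²`. -/
theorem eq_zero_of_isGeodesicallyComplete
    (hcov : ∀ (Y : Π g : G, TangentSpace 𝓘(ℝ, E) g) (g : G), MDiffAt (T% Y) g →
      cov Y g = leftInvariantConnection (rankOneBilin l Φ) Y g)
    (hlΦ : ∀ x, l (Φ x) = μ * l x) (hle : l e = 1) (h : IsGeodesicallyComplete cov) : μ = 0 := by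
  obtain ⟨γ, hγ, h₀⟩ := h ⟨1, leftTrivSymm E 1 e⟩
  let l' : E →L[ℝ] ℝ := LinearMap.toContinuousLinearMap (E := E) (F' := ℝ) l
  refine eq_zero_of_riccati (a := fun t => l' (leftTriv E (γ t) (velocity γ t))) (fun t => ?_) ?_
  · have h1 := (hγ.covDeriv_velocity t).hasDerivAt hcov (hγ.mdifferentiable t)
    refine (l'.hasFDerivAt.comp_hasDerivAt t h1).congr_deriv ?_
    set ξ := leftTriv E (γ t) (velocity γ t)
    have h2 : l' (rankOneBilin l Φ ξ ξ) = l' ξ * (μ * l' ξ) :=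
      (l.map_smul _ _).trans (congrArg (l' ξ * ·) (hlΦ ξ))
    rw [map_sub, map_zero, map_zero, h2]
    ring
  · have h1 : leftTriv E (γ 0) (velocity γ 0) = leftTriv E (1 : G) (leftTrivSymm E 1 e) :=
      congrArg (fun p : TangentBundle 𝓘(ℝ, E) G => leftTriv E p.1 p.2) h₀
    exact (congrArg l' (h1.trans (leftTriv_leftTrivSymm (E := E) 1 e))).trans hle

variable [CompleteSpace E]

/-- If `l ∘ Φ = 0`, then `l(γ')` is constant along a geodesic `γ`, and the geodesic equation in the
left trivialization becomes the linear equation `ξ' = -l(ξ(0)) Φ ξ`. -/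
theorem isGeodesicallyComplete_of_comp_eq_zero
    (hcov : ∀ (Y : Π g : G, TangentSpace 𝓘(ℝ, E) g) (g : G), MDiffAt (T% Y) g →
      cov Y g = leftInvariantConnection (rankOneBilin l Φ) Y g)
    (hlΦ : ∀ x, l (Φ x) = 0) : IsGeodesicallyComplete cov := by
  have : T2Space G := by
    have := topologicalGroup_of_lieGroup 𝓘(ℝ, E) ∞ (G := G)
    have : T1Space G := 𝓘(ℝ, E).t1Space G
    infer_instance
  rintro ⟨p, v⟩
  let l' : E →L[ℝ] ℝ := LinearMap.toContinuousLinearMap (E := E) (F' := ℝ) l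
  let Φ' : E →L[ℝ] E := LinearMap.toContinuousLinearMap (E := E) (F' := E) Φ
  let x := leftTriv E p v
  let T : E →L[ℝ] E := -(l' x • Φ')
  let ξ (t : ℝ) : E := NormedSpace.exp (t • T) x
  have hξ (t) : HasDerivAt ξ (T (ξ t)) t :=
    (ContinuousLinearMap.apply ℝ E x).hasFDerivAt.comp_hasDerivAt t (hasDerivAt_exp_smul_const' T t)
  have hξ₀ : ξ 0 = x := by simp [ξ]
  have hlT (y) : l' (T y) = 0 := by
    have h1 : l' (Φ' y) = 0 := hlΦ y
    simp [T, h1]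
  have hlξ (t) : l' (ξ t) = l' x := by
    have h1 (t) : HasDerivAt (fun t => l' (ξ t)) 0 t :=
      (l'.hasFDerivAt.comp_hasDerivAt t (hξ t)).congr_deriv (hlT _)
    rw [← hξ₀]
    exact is_const_of_deriv_eq_zero (fun t => (h1 t).differentiableAt) (fun t => (h1 t).deriv) t 0
  have hξc : ContDiff ℝ 1 ξ := by
    refine contDiff_one_iff_deriv.2 ⟨fun t => (hξ t).differentiableAt, ?_⟩
    rw [funext fun t => (hξ t).deriv]
    exact T.continuous.comp (continuous_iff_continuousAt.2 fun t => (hξ t).continuousAt)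
  obtain ⟨γ, hγ₀, hγ⟩ := exists_isLeftSolutionOn_univ hξc p
  refine ⟨γ, isGeodesic_of_hasMFDerivAt hcov (ξ := ξ) (fun t => (hξ t).congr_deriv ?_)
    fun t => hγ t trivial, ?_⟩
  · change T (ξ t) = -(l' (ξ t) • Φ' (ξ t))
    rw [hlξ]
    rfl
  · rw [velocity_eq_of_hasMFDerivAt (hγ 0 trivial), hγ₀, hξ₀, leftTrivSymm_leftTriv]

variable {u : LieIdeal ℝ (GroupLieAlgebra 𝓘(ℝ, E) G)}
  {J : Fin 3 → Module.End ℝ (GroupLieAlgebra 𝓘(ℝ, E) G)}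

theorem IsHypercomplex.isObataConnection (hJ : IsHypercomplex J) (hu : IsCodimOneAbelianIdeal u)
    (hle : l e = 1) (hlu : ∀ x, l x = 0 ↔ x ∈ u) (hJe : ∀ α, J α e ∈ u) :
    IsObataConnection J (leftInvariantConnection (G := G) (rankOneBilin l (obataEnd J l e))) := by
  refine isObataConnection_leftInvariantConnection _ (fun x y => ?_) J fun α x y => ?_
  · change l x • obataEnd J l e y - l y • obataEnd J l e x = ⁅x, y⁆
    rw [hu.lie_eq hle hlu x y, obataEnd_apply, obataEnd_apply]
    module
  · change l x • obataEnd J l e (J α y) = J α (l x • obataEnd J l e y)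
    rw [hJ.obataEnd_comm hu hle hlu hJe, map_smul]

end Obata

end

theorem corollary3p7 {E : Type*} [NormedAddCommGroup E] [NormedSpace ℝ E] [FiniteDimensional ℝ E]
    [CompleteSpace E] {G : Type*} [TopologicalSpace G] [ChartedSpace E G] [Group G]
    [LieGroup 𝓘(ℝ, E) ∞ G] [SimplyConnectedSpace G]
    (u : LieIdeal ℝ (GroupLieAlgebra 𝓘(ℝ, E) G)) (hu : IsCodimOneAbelianIdeal u)
    (J : Fin 3 → Module.End ℝ (GroupLieAlgebra 𝓘(ℝ, E) G)) (hJ : IsHypercomplex J) :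
    (∃ e₀ μ, IsAdapted J u e₀ μ) ∧
    (∃ cov : CovariantDerivative 𝓘(ℝ, E) E (TangentSpace 𝓘(ℝ, E) : G → Type _),
      IsObataConnection J cov) ∧
    ∀ e₀ μ, IsAdapted J u e₀ μ →
      ∀ cov : CovariantDerivative 𝓘(ℝ, E) E (TangentSpace 𝓘(ℝ, E) : G → Type _),
        IsObataConnection J cov → (IsGeodesicallyComplete cov ↔ μ = 0) := by
  obtain ⟨e, he, hJe⟩ := hJ.exists_transversal hu
  obtain ⟨l, hle, hlu⟩ := hu.exists_dual he
  refine ⟨⟨e, _, hJ.isAdapted hu hle hlu hJe⟩, ⟨_, hJ.isObataConnection hu hle hlu hJe⟩, ?_⟩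
  clear! l e
  intro e μ h cov hcov
  obtain ⟨l, hle, hlu⟩ := hu.exists_dual h.notMem
  have hlΦ (x) : l (obataEnd J l e x) = μ * l x := by
    rw [dual_obataEnd hle hlu, h.dual_eq hJ hle hlu]
  have heq (Y : Π g : G, TangentSpace 𝓘(ℝ, E) g) (g : G) (hY : MDiffAt (T% Y) g) :
      cov Y g = leftInvariantConnection (rankOneBilin l (obataEnd J l e)) Y g :=
    hcov.eq_of_mdifferentiableAt hJ (hJ.isObataConnection hu hle hlu h.mem) hY
  refine ⟨eq_zero_of_isGeodesicallyComplete heq hlΦ hle, ?_⟩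
  rintro rfl
  exact isGeodesicallyComplete_of_comp_eq_zero heq fun x => by rw [hlΦ, zero_mul]
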